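/- Let $\Gamma=(V,E)$ be an undirected graph without loops or multiple edges, and let $A_\Gamma^+$ be its right-angled Artin monoid, i.e. the graph product over $\Gamma$ of copies of $\mathbb{N}$, one for each $v\in V$: the quotient of the free product of these copies, with canonical generators $a_v$, by the congruence generated by $st\sim ts$ for $s,t$ in the copies at adjacent vertices. Let $V_u$ be the set of universal vertices (those adjacent to every other vertex), let $(\Gamma_i)_{i\in I}$ with $\Gamma_i=(V_i,E_i)$ be the coconnected components of $\Gamma$ (the subgraphs induced on the connected components of the complementary graph), and put $I_2=\{i\in I : |V_i|\ge 2\}$. For $s\in A_\Gamma^+=\bigoplus_{i\in I}A_{\Gamma_i}^+$ let $s_i\in A_{\Gamma_i}^+$ be the $i$-th component, i.e. the image of $s$ under the homomorphism with $a_v\mapsto a_v$ for $v\in V_i$ and $a_v\mapsto 1$ for $v\notin V_i$. For a monoid $S$, let $S^*$ be its group of units, $S_c=\{a\in S : aS\cap sS\neq\emptyset \text{ for all } s\in S\}$ its core, and $S_{ci}$ the set of core irreducible elements, that is, of all $s\in S\setminus S_c$ such that every factorisation $s=ta$ with $t\in S$, $a\in S_c$ has $a\in S^*$; put $S_{ci}^1=S_{ci}\cup\{1\}$.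 Write $s\sim t$ (core related) if $sa=tb$ for some $a,b\in S_c$, and let $\alpha\colon S_c\curvearrowright S/_\sim$ be the action $a.[s]=[as]$. $S$ is core factorable if $S=S_{ci}^1S_c$; $S_{ci}\subset S$ is $\cap$-closed if $s,t\in S_{ci}$, $r\in S$ and $sS\cap tS=rS$ imply $r\in S_{ci}$. $S$ has finite propagation if there is a transversal $T\subset S_{ci}^1$ for $S/_\sim$ such that every $s\in S$ can be written as $s=tc$ with $t\in T$, $c\in S_c$, and such that for every $a\in S_c$ the set of all $c\in S_c$ with $af=tc$ for some $f,t\in T$ is finite. An action of a monoid $M$ on a set $X$ is faithful if for all $a\ne b$ in $M$ there is $x\in X$ with $a.x\neq b.x$, and almost free if for all $a\neq b$ in $M$ the set $\{x\in X : a.x=b.x\}$ is finite. Then: 1. $(A_\Gamma^+)^*=\{1\}$; $(A_\Gamma^+)_c=\bigoplus_{v\in V_u}\mathbb{N}$, that is, the homomorphism $\bigoplus_{v\in V_u}\mathbb{N}\to A_\Gamma^+$ sending the generator at $v$ to $a_v$ is injective with image $(A_\Gamma^+)_c$; and $(A_\Gamma^+)_{ci}^1=\bigoplus_{i\in I_2}A_{\Gamma_i}^+$,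 that is, the homomorphism $\bigoplus_{i\in I_2}A_{\Gamma_i}^+\to A_\Gamma^+$ that extends the canonical homomorphisms $A_{\Gamma_i}^+\to A_\Gamma^+$, $a_v\mapsto a_v$, is injective with image $(A_\Gamma^+)_{ci}^1$. 2. Two elements $s,t\in A_\Gamma^+$ are core related if and only if $s_i=t_i$ for all $i\in I_2$. 3. $A_\Gamma^+$ is core factorable, $(A_\Gamma^+)_{ci}\subset A_\Gamma^+$ is $\cap$-closed, and $A_\Gamma^+$ has finite propagation. 4. The action $\alpha\colon (A_\Gamma^+)_c\curvearrowright A_\Gamma^+/_\sim$ is faithful if and only if $\Gamma$ has no universal vertex. 5. The action $\alpha\colon (A_\Gamma^+)_c\curvearrowright A_\Gamma^+/_\sim$ is almost free if and only if $V_u=\emptyset$ or $V_u=V$. Here $V_u=\emptyset$ holds if and only if the core of $A_\Gamma^+$ is trivial, and $V_u=V$ holds if and only if $A_\Gamma^+$ is the free abelian monoid on $V$ (via $a_v\mapsto v$). -/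

import Mathlib

/-! ### Monoids: principal right ideals, core, core irreducible elements -/

section MonoidNotions

variable (S : Type*) [Monoid S]

/-- The principal right ideal `sS`. -/
def rightIdeal {S : Type*} [Monoid S] (s : S) : Set S := {x | ∃ y, x = s * y}

/-- `s ⊥ t`: the principal right ideals `sS` and `tS` are disjoint. -/
def Orthogonal {S : Type*} [Monoid S] (s t : S) : Prop := rightIdeal s ∩ rightIdeal t = ∅

theorem not_orthogonal_iff {S : Type*} [Monoid S] (s t : S) :
    ¬ Orthogonal s t ↔ ∃ x y, s * x = t * y := by
  unfold Orthogonal rightIdeal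
  rw [← ne_eq, ← Set.nonempty_iff_ne_empty]
  constructor
  · rintro ⟨z, ⟨x, hx⟩, ⟨y, hy⟩⟩
    exact ⟨x, y, hx ▸ hy⟩
  · rintro ⟨x, y, h⟩
    exact ⟨s * x, ⟨x, rfl⟩, ⟨y, h⟩⟩

/-- The core `S_c = {a | a is not orthogonal to any s}`. -/
def core : Submonoid S where
  carrier := {a | ∀ s, ¬ Orthogonal a s}
  one_mem' s := (not_orthogonal_iff _ _).2 ⟨s, 1, by simp⟩
  mul_mem' := by
    intro a b ha hb s
    obtain ⟨x, y, hxy⟩ := (not_orthogonal_iff _ _).1 (ha s)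
    obtain ⟨z, w, hzw⟩ := (not_orthogonal_iff _ _).1 (hb x)
    exact (not_orthogonal_iff _ _).2
      ⟨z, y * w, by rw [mul_assoc, hzw, ← mul_assoc, hxy, mul_assoc]⟩

/-- The core irreducible elements `S_ci`: those `s ∉ S_c` such that in every factorisation
`s = t * a` with `a ∈ S_c` the factor `a` is invertible. -/
def coreIrreducibles : Set S :=
  {s | s ∉ core S ∧ ∀ t a, a ∈ core S → s = t * a → IsUnit a}

/-- The unitisation `S_ci ∪ {1}`. -/
def unitisedCoreIrreducibles : Set S := coreIrreducibles S ∪ {1}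

/-- The core relation: `s ∼ t` iff `s * a = t * b` for some `a, b ∈ S_c`. -/
def CoreRel {S : Type*} [Monoid S] (s t : S) : Prop :=
  ∃ a ∈ core S, ∃ b ∈ core S, s * a = t * b

/-- `S / ∼`. -/
def CoreQuotient : Type _ := Quot (CoreRel (S := S))

/-- The action `α` of `S_c` on `S / ∼`, given by `a • [s] = [a * s]`. -/
instance : MulAction (core S) (CoreQuotient S) where
  smul a := Quot.map (fun s => (a : S) * s) (by
    rintro s t ⟨b, hb, c, hc, h⟩
    exact ⟨b, hb, c, hc, by rw [mul_assoc, h, mul_assoc]⟩)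
  one_smul x := by
    induction x using Quot.ind with
    | mk s => exact congrArg (Quot.mk _) (one_mul s)
  mul_smul a b x := by
    induction x using Quot.ind with
    | mk s => exact congrArg (Quot.mk _) (mul_assoc (a : S) b s)

/-- `S = S_ci^1 S_c`. -/
def IsCoreFactorable : Prop :=
  ∀ s : S, ∃ t ∈ unitisedCoreIrreducibles S, ∃ a ∈ core S, s = t * a

/-- `S_ci ⊆ S` is `∩`-closed. -/
def IsInterClosed : Prop :=
  ∀ s ∈ coreIrreducibles S, ∀ t ∈ coreIrreducibles S, ∀ r : S,
    rightIdeal s ∩ rightIdeal t = rightIdeal r → r ∈ coreIrreducibles S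

/-- Finite propagation: there is a transversal `T ⊆ S_ci^1` of `S / ∼` such that every `s` has
a factorisation `s = t * c` with `t ∈ T`, `c ∈ S_c`, and such that for each `a ∈ S_c` only
finitely many core parts `c` occur in the factorisations `a * f = t * c` as `f` ranges over
`T`. -/
def HasFinitePropagation : Prop :=
  ∃ T ⊆ unitisedCoreIrreducibles S,
    (∀ s : S, ∃! t, t ∈ T ∧ CoreRel s t) ∧
    (∀ s : S, ∃ t ∈ T, ∃ c ∈ core S, s = t * c) ∧
    ∀ a ∈ core S, {c | c ∈ core S ∧ ∃ f ∈ T, ∃ t ∈ T, a * f = t * c}.Finite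

/-- An action of a monoid is almost free if any two distinct elements of the monoid agree at
only finitely many points. -/
def IsAlmostFree (M X : Type*) [Monoid M] [MulAction M X] : Prop :=
  ∀ a b : M, a ≠ b → {x : X | a • x = b • x}.Finite

/-- The direct sum of a family of (not necessarily commutative) monoids: the finitely supported
elements of the product. -/
def directSum {I : Type*} (M : I → Type*) [∀ i, Monoid (M i)] : Submonoid (∀ i, M i) where
  carrier := {f | {i | f i ≠ 1}.Finite}
  one_mem' := by simp
  mul_mem' := by
    intro f g hf hg
    refine (hf.union hg).subset fun i hi => ?_
    by_contra h
    simp only [Set.mem_union, Set.mem_ofPred_eq, not_or, not_not] at h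
    exact hi (by simp [h.1, h.2])

open Classical in
/-- The `i`-th summand inside the direct sum. -/
noncomputable def directSum.single {I : Type*} (M : I → Type*) [∀ i, Monoid (M i)] (i : I) :
    M i →* directSum M :=
  (MonoidHom.mulSingle M i).codRestrict (directSum M) fun x => by
    refine (Set.finite_singleton i).subset fun j hj => ?_
    by_contra h
    exact hj (Pi.mulSingle_eq_of_ne h x)

end MonoidNotions

/-! ### Graph products and right-angled Artin monoids -/

section GraphProducts

variable {V : Type*} (Γ : SimpleGraph V)

/-- The commutation relations of a graph product, on the free product of the vertex monoids. -/
inductive GraphProductRel (S : V → Type*) [∀ v, Monoid (S v)] :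
    Monoid.CoprodI S → Monoid.CoprodI S → Prop
  | comm {v w : V} (h : Γ.Adj v w) (s : S v) (t : S w) :
      GraphProductRel S (Monoid.CoprodI.of s * Monoid.CoprodI.of t)
        (Monoid.CoprodI.of t * Monoid.CoprodI.of s)

/-- The graph product of the monoids `S v`: the quotient of their free product by the
congruence generated by `(s * t, t * s)` for `s ∈ S v`, `t ∈ S w` with `v`, `w` adjacent. -/
abbrev GraphProduct (S : V → Type*) [∀ v, Monoid (S v)] : Type _ :=
  (conGen (GraphProductRel Γ S)).Quotient

/-- The right-angled Artin monoid of `Γ`: the graph product with all vertex monoids `ℕ`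
(written multiplicatively). -/
abbrev ArtinMonoid : Type _ := GraphProduct Γ (fun _ => Multiplicative ℕ)

namespace ArtinMonoid

/-- The generator `a_v`. -/
def gen (v : V) : ArtinMonoid Γ :=
  (conGen (GraphProductRel Γ fun _ => Multiplicative ℕ)).mk'
    (Monoid.CoprodI.of (i := v) (Multiplicative.ofAdd 1))

variable {Γ}

/-- The universal property: elements `f v` of a monoid that commute for adjacent vertices
define a homomorphism with `a_v ↦ f v`. -/
def lift {M : Type*} [Monoid M] (f : V → M) (hf : ∀ v w, Γ.Adj v w → Commute (f v) (f w)) :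
    ArtinMonoid Γ →* M :=
  Con.lift _ (Monoid.CoprodI.lift fun v => powersHom M (f v)) <| Con.conGen_le.2 <| by
    rintro _ _ ⟨h, s, t⟩
    simp only [Con.ker_rel, map_mul, Monoid.CoprodI.lift_of, powersHom_apply]
    exact ((hf _ _ h).pow_pow _ _)

theorem lift_gen {M : Type*} [Monoid M] (f : V → M)
    (hf : ∀ v w, Γ.Adj v w → Commute (f v) (f w)) (v : V) : lift f hf (gen Γ v) = f v := by
  simp [lift, gen, powersHom_apply]

theorem gen_commute {v w : V} (h : Γ.Adj v w) : Commute (gen Γ v) (gen Γ w) :=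
  (Con.eq _).2 (ConGen.Rel.of _ _ (GraphProductRel.comm h _ _))

variable (Γ)

/-- The homomorphism from the Artin monoid of the induced subgraph on `U` to that of `Γ` with
`a_u ↦ a_u` for `u ∈ U`. -/
def inclusion (U : Set V) : ArtinMonoid (Γ.induce U) →* ArtinMonoid Γ :=
  lift (fun u => gen Γ u.1) fun _ _ h => gen_commute h

open Classical in
/-- The homomorphism from the Artin monoid of `Γ` to that of the induced subgraph on `U` with
`a_v ↦ a_v` for `v ∈ U` and `a_v ↦ 1` for `v ∉ U`. -/
noncomputable def projection (U : Set V) : ArtinMonoid Γ →* ArtinMonoid (Γ.induce U) :=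
  lift (fun v => if h : v ∈ U then gen (Γ.induce U) ⟨v, h⟩ else 1) <| by
    intro v w h
    by_cases hv : v ∈ U <;> by_cases hw : w ∈ U <;> simp only [hv, hw, dite_true, dite_false]
    · exact gen_commute (Γ := Γ.induce U) (v := ⟨v, hv⟩) (w := ⟨w, hw⟩) h
    · exact Commute.one_right _
    · exact Commute.one_left _
    · exact Commute.one_left _

end ArtinMonoid

/-- The index set `I` of the coconnected components of `Γ`, i.e. the connected components of
the complementary graph. The vertex set `V_i` is `i.supp`. -/
abbrev CoComponent : Type _ := Γᶜ.ConnectedComponent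

/-- The set `I_2` of coconnected components with at least two vertices. -/
def nontrivialCoComponents : Set (CoComponent Γ) := {i | i.supp.Nontrivial}

/-- The coconnected component `Γ_i = (V_i, E_i)`. -/
abbrev coComponentGraph (i : CoComponent Γ) : SimpleGraph i.supp := Γ.induce i.supp

/-- The component `s_i ∈ A_{Γ_i}^+` of `s ∈ A_Γ^+ = ⨁ i, A_{Γ_i}^+`. -/
noncomputable def ArtinMonoid.component (i : CoComponent Γ) :
    ArtinMonoid Γ →* ArtinMonoid (coComponentGraph Γ i) :=
  ArtinMonoid.projection Γ i.supp

end GraphProducts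

/-! ### Direct sums of monoids -/

namespace directSum

variable {I : Type*} {M : I → Type*} [∀ i, Monoid (M i)] {N : Type*} [Monoid N]

/-! A vertex is universal exactly when it is isolated in the complementary graph, so the coconnected
components are the universal vertices, one by one, and the members of `I_2`. Distinct components are
completely joined in `Γ`, hence the monoid is the direct product of the sum of the Artin monoids
over `I_2` and a central free abelian monoid on the universal vertices. This splitting carries the
whole proof: `componentSumHom` and `coreHom` embed the factors, `componentPart` and `corePart`
retract onto them, and `componentSumHom_mul_coreHom` reassembles an element (`ext_parts`).

The core is the central factor: central elements meet every principal right ideal, while an element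
with nontrivial `componentPart` can be written to start with a generator `v` that has a
non-neighbour `w`, and projecting to the free monoid on `v`, `w` shows that it is orthogonal to the
generator at `w` (`gen_mul_ne_gen_mul`). Then core irreducibility (up to the unit) means trivial
`corePart`, the core relation means equal `componentPart`, and the action `α` is trivial. Thus `α`
is faithful iff the core is trivial, and almost free iff the core is trivial or the quotient is
finite. -/

theorem coe_single_same (i : I) (x : M i) : (single M i x : ∀ i, M i) i = x := by
  classical
  exact Pi.mulSingle_eq_same (M := M) i x

theorem coe_single_of_ne {i j : I} (h : j ≠ i) (x : M i) :
    (single M i x : ∀ i, M i) j = 1 := by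
  classical
  exact Pi.mulSingle_eq_of_ne h x

/-- The set of indices of the nontrivial components. -/
noncomputable def support (f : directSum M) : Finset I :=
  Set.Finite.toFinset (s := {i | f.1 i ≠ 1}) f.2

theorem mem_support {f : directSum M} {i : I} : i ∈ support f ↔ f.1 i ≠ 1 :=
  Set.Finite.mem_toFinset _

theorem notMem_support {f : directSum M} {i : I} : i ∉ support f ↔ f.1 i = 1 := by
  rw [mem_support, not_not]

/-- A submonoid of the direct sum that contains all summands is everything. -/
theorem mem_of_single_mem (P : Submonoid (directSum M)) (h : ∀ i x, single M i x ∈ P)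
    (f : directSum M) : f ∈ P := by
  classical
  suffices ∀ (F : Finset I) (f : directSum M), (∀ i, f.1 i ≠ 1 → i ∈ F) → f ∈ P from
    this (support f) f fun _ => mem_support.2
  intro F
  induction F using Finset.induction_on with
  | empty =>
    intro f hf
    have : f = 1 := Subtype.ext (funext fun i => by
      by_contra hi
      simpa using hf i hi)
    exact this ▸ P.one_mem
  | insert i F _ ih =>
    intro f hf
    have hg : Function.update f.1 i 1 ∈ directSum M := f.2.subset fun j hj => by
      by_cases hji : j = i
      · subst hji
        exact absurd (Function.update_self ..) hj
      · exact fun e => hj ((Function.update_of_ne hji _ _).trans e)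
    have hfg : f = single M i (f.1 i) * ⟨Function.update f.1 i 1, hg⟩ := by
      refine Subtype.ext (funext fun j => ?_)
      change f.1 j = (single M i (f.1 i) : ∀ i, M i) j * Function.update f.1 i 1 j
      by_cases hji : j = i
      · subst hji
        rw [coe_single_same, Function.update_self, mul_one]
      · rw [coe_single_of_ne hji, Function.update_of_ne hji, one_mul]
    rw [hfg]
    refine P.mul_mem (h _ _) (ih _ fun j hj => ?_)
    by_cases hji : j = i
    · subst hji
      exact absurd (Function.update_self j 1 f.1) hj
    · refine Finset.mem_of_mem_insert_of_ne (hf j fun e => hj ?_) hji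
      exact (Function.update_of_ne hji _ _).trans e

theorem hom_ext {f g : directSum M →* N} (h : ∀ i x, f (single M i x) = g (single M i x)) :
    f = g :=
  MonoidHom.ext <| mem_of_single_mem (f.eqLocusM g) h

/-- The extra factors are `φ i 1 = 1`. This allows `f`, `g` and `f * g`, whose supports differ, to
be compared over one common index set in `lift`. -/
theorem noncommProd_eq_of_support_subset (φ : ∀ i, M i →* N)
    (hφ : ∀ ⦃i j⦄, i ≠ j → ∀ x y, Commute (φ i x) (φ j y)) (f : directSum M) {F : Finset I}
    (hF : support f ⊆ F) :
    (support f).noncommProd (fun i => φ i (f.1 i)) (fun _ _ _ _ h => hφ h _ _) =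
      F.noncommProd (fun i => φ i (f.1 i)) (fun _ _ _ _ h => hφ h _ _) := by
  classical
  have key : ∀ E : Finset I, Disjoint (support f) E →
      (support f ∪ E).noncommProd (fun i => φ i (f.1 i)) (fun _ _ _ _ h => hφ h _ _) =
        (support f).noncommProd (fun i => φ i (f.1 i)) (fun _ _ _ _ h => hφ h _ _) := by
    intro E hE
    refine (Finset.noncommProd_union_of_disjoint hE _ _).trans ?_
    rw [Finset.noncommProd_eq_pow_card E _ _ 1, one_pow, mul_one]
    intro i hi
    have : f.1 i = 1 := by
      by_contra hne
      exact Finset.disjoint_left.1 hE (mem_support.2 hne) hi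
    rw [this, map_one]
  rw [← key _ Finset.disjoint_sdiff]
  exact Finset.noncommProd_congr (Finset.union_sdiff_of_subset hF) (fun _ _ => rfl) _

/-- The universal property of the direct sum: homomorphisms with commuting images. -/
noncomputable def lift (φ : ∀ i, M i →* N)
    (hφ : ∀ ⦃i j⦄, i ≠ j → ∀ x y, Commute (φ i x) (φ j y)) : directSum M →* N where
  toFun f := (support f).noncommProd (fun i => φ i (f.1 i)) fun _ _ _ _ h => hφ h _ _
  map_one' := by
    refine (Finset.noncommProd_eq_pow_card _ _ _ 1 fun i _ => ?_).trans (one_pow _)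
    exact map_one (φ i)
  map_mul' f g := by
    classical
    have hfg : support (f * g) ⊆ support f ∪ support g := by
      intro i hi
      by_contra hn
      rw [Finset.mem_union, not_or, notMem_support, notMem_support] at hn
      refine mem_support.1 hi ?_
      change f.1 i * g.1 i = 1
      rw [hn.1, hn.2, one_mul]
    rw [noncommProd_eq_of_support_subset φ hφ _ hfg,
      noncommProd_eq_of_support_subset φ hφ f (Finset.subset_union_left (s₂ := support g)),
      noncommProd_eq_of_support_subset φ hφ g (Finset.subset_union_right (s₁ := support f))]
    exact (Finset.noncommProd_congr rfl (fun i _ => map_mul (φ i) _ _) _).trans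
      (Finset.noncommProd_mul_distrib (fun i => φ i (f.1 i)) (fun i => φ i (g.1 i)) _ _
        fun _ _ _ _ h => hφ h _ _)

theorem lift_single (φ : ∀ i, M i →* N)
    (hφ : ∀ ⦃i j⦄, i ≠ j → ∀ x y, Commute (φ i x) (φ j y)) (i : I) (x : M i) :
    lift φ hφ (single M i x) = φ i x := by
  have h : support (single M i x) ⊆ {i} := by
    intro j hj
    by_contra hji
    exact mem_support.1 hj
      (coe_single_of_ne (by simpa using hji) x)
  refine (noncommProd_eq_of_support_subset φ hφ _ h).trans ?_
  rw [Finset.noncommProd_singleton, coe_single_same]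

end directSum

/-! ### Homomorphisms from free abelian monoids -/

section FreeAbelian

variable {α N : Type*} [Monoid N]

/-- The homomorphism from a free abelian monoid determined by central elements. -/
noncomputable def centralHom (f : α → N) (hf : ∀ a s, Commute s (f a)) :
    Multiplicative (α →₀ ℕ) →* N :=
  (Submonoid.center N).subtype.comp <| AddMonoidHom.toMultiplicativeLeft <|
    Finsupp.liftAddHom fun a => multiplesHom _ <| Additive.ofMul
      ⟨f a, Submonoid.mem_center_iff.2 fun s => hf a s⟩

theorem centralHom_single (f : α → N) (hf : ∀ a s, Commute s (f a)) (a : α) :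
    centralHom f hf (Multiplicative.ofAdd (Finsupp.single a 1)) = f a := by
  simp [centralHom]

theorem centralHom_commute (f : α → N) (hf : ∀ a s, Commute s (f a))
    (c : Multiplicative (α →₀ ℕ)) (s : N) : Commute s (centralHom f hf c) :=
  Submonoid.mem_center_iff.1 (Subtype.prop _) s

theorem freeAbelian_hom_ext {f g : Multiplicative (α →₀ ℕ) →* N}
    (h : ∀ a, f (Multiplicative.ofAdd (Finsupp.single a 1)) =
      g (Multiplicative.ofAdd (Finsupp.single a 1))) : f = g := by
  have : MonoidHom.toAdditiveRight f = MonoidHom.toAdditiveRight g :=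
    Finsupp.addHom_ext' fun a => AddMonoidHom.ext_nat (h a)
  exact MonoidHom.toAdditiveRight.injective this

end FreeAbelian

/-! ### Generation of Artin monoids -/

namespace ArtinMonoid

variable {V : Type*} {Γ : SimpleGraph V}

theorem mem_of_gen_mem (P : Submonoid (ArtinMonoid Γ)) (h : ∀ v, gen Γ v ∈ P)
    (s : ArtinMonoid Γ) : s ∈ P := by
  induction s using Con.induction_on with
  | H x =>
    induction x using Monoid.CoprodI.induction_on with
    | one => exact P.one_mem
    | of v n =>
      have hn : (Monoid.CoprodI.of (M := fun _ : V => Multiplicative ℕ) (i := v) n) =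
          Monoid.CoprodI.of (i := v) (Multiplicative.ofAdd 1) ^ n.toAdd := by
        rw [← map_pow, ← ofAdd_nsmul]
        simp
      rw [hn]
      exact P.pow_mem (h v) _
    | mul x y hx hy => exact P.mul_mem hx hy

theorem hom_ext {M : Type*} [Monoid M] {f g : ArtinMonoid Γ →* M}
    (h : ∀ v, f (gen Γ v) = g (gen Γ v)) : f = g :=
  MonoidHom.ext <| mem_of_gen_mem (f.eqLocusM g) h

theorem eq_one_or_exists_gen_mul (s : ArtinMonoid Γ) : s = 1 ∨ ∃ v t, s = gen Γ v * t := by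
  let P : Submonoid (ArtinMonoid Γ) :=
    { carrier := {s | s = 1 ∨ ∃ v t, s = gen Γ v * t}
      one_mem' := Or.inl rfl
      mul_mem' := by
        rintro a b (rfl | ⟨v, t, rfl⟩) hb
        · simpa using hb
        · exact Or.inr ⟨v, t * b, mul_assoc _ _ _⟩ }
  exact mem_of_gen_mem P (fun v => Or.inr ⟨v, 1, (mul_one _).symm⟩) s

theorem commute_of_gen {z : ArtinMonoid Γ} (h : ∀ v, Commute (gen Γ v) z) (s : ArtinMonoid Γ) :
    Commute s z :=
  mem_of_gen_mem
    { carrier := {s | Commute s z}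
      one_mem' := Commute.one_left z
      mul_mem' := fun ha hb => Commute.mul_left ha hb } h s

/-! ### Word length and projections to free monoids -/

variable (Γ)

/-- The word length. -/
def length : ArtinMonoid Γ →* Multiplicative ℕ :=
  lift (fun _ => Multiplicative.ofAdd 1) fun _ _ _ => Commute.all _ _

variable {Γ}

/-- Length is additive and every generator has length one, so a product that begins with a generator
has positive length. -/
theorem eq_one_of_mul_eq_one {s r : ArtinMonoid Γ} (h : s * r = 1) : s = 1 := by
  obtain rfl | ⟨v, t, rfl⟩ := eq_one_or_exists_gen_mul s
  · rfl
  · have := congrArg (fun x => (length Γ x).toAdd) h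
    simp only [map_mul, map_one, length, lift_gen, toAdd_mul, toAdd_ofAdd, toAdd_one] at this
    omega

theorem isUnit_iff (s : ArtinMonoid Γ) : IsUnit s ↔ s = 1 := by
  refine ⟨fun h => ?_, fun h => h ▸ isUnit_one⟩
  obtain ⟨r, hr⟩ := h.exists_right_inv
  exact eq_one_of_mul_eq_one hr

open Classical in
/-- For non-adjacent `v ≠ w`, the projection of the Artin monoid onto the free monoid on `v` and
`w`. -/
noncomputable def toFreeMonoid {v w : V} (h : ¬ Γ.Adj v w) : ArtinMonoid Γ →* FreeMonoid V :=
  lift (fun x => if x = v ∨ x = w then FreeMonoid.of x else 1) <| by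
    intro x y hxy
    split_ifs with hx hy
    -- Only the mixed cases are at stake, and there the adjacency of `x` and `y` contradicts `h`.
    · rcases hx with rfl | rfl <;> rcases hy with rfl | rfl
      · exact Commute.refl _
      · exact absurd hxy h
      · exact absurd hxy.symm h
      · exact Commute.refl _
    · exact Commute.one_right _
    · exact Commute.one_left _
    · exact Commute.one_left _

/-- The images in the free monoid on `v` and `w` have different first letters. -/
theorem gen_mul_ne_gen_mul {v w : V} (hne : v ≠ w) (h : ¬ Γ.Adj v w) (s t : ArtinMonoid Γ) :
    gen Γ v * s ≠ gen Γ w * t := by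
  intro e
  have := congrArg (fun x => (toFreeMonoid h x).toList.head?) e
  simp [toFreeMonoid, lift_gen, FreeMonoid.toList_mul] at this
  exact hne this

theorem gen_commute_iff {v w : V} : Commute (gen Γ v) (gen Γ w) ↔ v = w ∨ Γ.Adj v w := by
  refine ⟨fun h => ?_, ?_⟩
  · by_contra! hn
    exact gen_mul_ne_gen_mul hn.1 hn.2 _ _ h.eq
  · rintro (rfl | h)
    · exact Commute.refl _
    · exact gen_commute h

theorem inclusion_gen (U : Set V) (u : U) :
    inclusion Γ U (gen (Γ.induce U) u) = gen Γ u.1 :=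
  lift_gen _ _ _

theorem projection_gen_of_mem {U : Set V} {v : V} (h : v ∈ U) :
    projection Γ U (gen Γ v) = gen (Γ.induce U) ⟨v, h⟩ :=
  (lift_gen _ _ _).trans (dif_pos h)

theorem projection_gen_of_notMem {U : Set V} {v : V} (h : v ∉ U) :
    projection Γ U (gen Γ v) = 1 :=
  (lift_gen _ _ _).trans (dif_neg h)

/-! ### The two direct factors -/

theorem gen_commute_of_mem_universalVerts {v : V} (hv : v ∈ Γ.universalVerts)
    (s : ArtinMonoid Γ) : Commute s (gen Γ v) :=
  commute_of_gen (fun w => by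
    by_cases h : v = w
    · exact h ▸ Commute.refl _
    · exact (gen_commute (hv h)).symm) s

theorem adj_of_mem_supp_of_ne {i j : CoComponent Γ} (hij : i ≠ j) {v w : V} (hv : v ∈ i.supp)
    (hw : w ∈ j.supp) : Γ.Adj v w := by
  by_contra h
  rw [SimpleGraph.ConnectedComponent.mem_supp_iff] at hv hw
  have hne : v ≠ w := by
    rintro rfl
    exact hij (hv.symm.trans hw)
  refine hij ?_
  rw [← hv, ← hw]
  exact SimpleGraph.ConnectedComponent.connectedComponentMk_eq_of_adj
    ((SimpleGraph.compl_adj ..).2 ⟨hne, h⟩)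

/-- Universal vertices are the isolated vertices of the complement, so their components are
singletons. -/
theorem mem_nontrivialCoComponents_iff {i : CoComponent Γ} {v : V} (hv : v ∈ i.supp) :
    i ∈ nontrivialCoComponents Γ ↔ v ∉ Γ.universalVerts := by
  have hv' := hv
  rw [SimpleGraph.ConnectedComponent.mem_supp_iff] at hv'
  constructor
  · intro hi hu
    obtain ⟨w, hw, hwv⟩ := hi.exists_ne v
    rw [SimpleGraph.ConnectedComponent.mem_supp_iff, ← hv'] at hw
    obtain ⟨p⟩ := SimpleGraph.ConnectedComponent.exact hw.symm
    -- The first edge of a path in the complement leaving `v` would contradict universality of `v`.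
    cases p with
    | nil => exact hwv rfl
    | cons h _ => exact h.2 (hu h.1)
  · intro hu
    have : ∃ w, v ≠ w ∧ ¬ Γ.Adj v w := by
      by_contra! hn
      exact hu fun w hw => hn w hw
    obtain ⟨w, hne, hw⟩ := this
    refine ⟨v, hv, w, ?_, hne⟩
    rw [SimpleGraph.ConnectedComponent.mem_supp_iff, ← hv']
    exact (SimpleGraph.ConnectedComponent.connectedComponentMk_eq_of_adj
      ((SimpleGraph.compl_adj ..).2 ⟨hne, hw⟩)).symm

variable (Γ)

/-- The homomorphism from the free abelian monoid on the universal vertices. -/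
noncomputable def coreHom : Multiplicative (Γ.universalVerts →₀ ℕ) →* ArtinMonoid Γ :=
  centralHom (fun v => gen Γ v) fun v => gen_commute_of_mem_universalVerts v.2

open Classical in
/-- The retraction onto the free abelian monoid on the universal vertices. -/
noncomputable def corePart : ArtinMonoid Γ →* Multiplicative (Γ.universalVerts →₀ ℕ) :=
  lift (fun v => if h : v ∈ Γ.universalVerts then
    Multiplicative.ofAdd (Finsupp.single ⟨v, h⟩ 1) else 1) fun _ _ _ => Commute.all _ _

/-- The direct sum of the Artin monoids of the nontrivial coconnected components. -/
abbrev ComponentSum : Type _ :=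
  directSum fun i : nontrivialCoComponents Γ => ArtinMonoid (coComponentGraph Γ i)

theorem inclusion_commute {i j : CoComponent Γ} (hij : i ≠ j)
    (x : ArtinMonoid (coComponentGraph Γ i)) (y : ArtinMonoid (coComponentGraph Γ j)) :
    Commute (inclusion Γ i.supp x) (inclusion Γ j.supp y) := by
  refine mem_of_gen_mem
    { carrier := {x | ∀ y, Commute (inclusion Γ i.supp x) (inclusion Γ j.supp y)}
      one_mem' := fun y => by rw [map_one]; exact Commute.one_left _
      mul_mem' := fun ha hb y => by rw [map_mul]; exact (ha y).mul_left (hb y) } ?_ x y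
  intro v y
  refine mem_of_gen_mem
    { carrier := {y | Commute (inclusion Γ i.supp (gen _ v)) (inclusion Γ j.supp y)}
      one_mem' := by
        change Commute _ _
        rw [map_one]
        exact Commute.one_right _
      mul_mem' := fun {a b} ha hb => by
        change Commute _ _
        rw [map_mul]
        exact Commute.mul_right ha hb } ?_ y
  intro w
  change Commute _ _
  rw [inclusion_gen, inclusion_gen]
  exact gen_commute (adj_of_mem_supp_of_ne hij v.2 w.2)

/-- The homomorphism from the direct sum of the Artin monoids of the nontrivial coconnected
components. -/
noncomputable def componentSumHom : ComponentSum Γ →* ArtinMonoid Γ :=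
  directSum.lift (fun i => inclusion Γ i.1.supp) fun _ _ h =>
    inclusion_commute Γ fun e => h (Subtype.ext e)

/-- The retraction onto the direct sum of the Artin monoids of the nontrivial coconnected
components. -/
noncomputable def componentPart : ArtinMonoid Γ →* ComponentSum Γ :=
  MonoidHom.codRestrict (MonoidHom.pi fun i : nontrivialCoComponents Γ => component Γ i.1)
    (directSum fun i : nontrivialCoComponents Γ => ArtinMonoid (coComponentGraph Γ i)) <|
    mem_of_gen_mem ((directSum fun i : nontrivialCoComponents Γ =>
      ArtinMonoid (coComponentGraph Γ i)).comap
        (MonoidHom.pi fun i : nontrivialCoComponents Γ => component Γ i.1)) fun v => by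
      -- Finite support need only be checked on generators, and a vertex lies in just one component.
      refine Set.Subsingleton.finite fun i hi j hj => ?_
      have key : ∀ k : nontrivialCoComponents Γ, component Γ k.1 (gen Γ v) ≠ 1 →
          v ∈ k.1.supp := fun k hk => by
        by_contra h
        exact hk (projection_gen_of_notMem h)
      exact Subtype.ext <|
        ((SimpleGraph.ConnectedComponent.mem_supp_iff _ _).1 (key i hi)).symm.trans
        ((SimpleGraph.ConnectedComponent.mem_supp_iff _ _).1 (key j hj))

variable {Γ}

theorem coreHom_single (v : Γ.universalVerts) :
    coreHom Γ (Multiplicative.ofAdd (Finsupp.single v 1)) = gen Γ v :=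
  centralHom_single _ _ v

theorem coreHom_commute (c : Multiplicative (Γ.universalVerts →₀ ℕ)) (s : ArtinMonoid Γ) :
    Commute s (coreHom Γ c) :=
  centralHom_commute _ _ c s

theorem componentSumHom_single (i : nontrivialCoComponents Γ)
    (x : ArtinMonoid (coComponentGraph Γ i)) :
    componentSumHom Γ (directSum.single (fun i : nontrivialCoComponents Γ =>
      ArtinMonoid (coComponentGraph Γ i)) i x) = inclusion Γ i.1.supp x :=
  directSum.lift_single (M := fun i : nontrivialCoComponents Γ =>
    ArtinMonoid (coComponentGraph Γ i)) (fun i => inclusion Γ i.1.supp) _ i x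

theorem componentPart_apply (s : ArtinMonoid Γ) (i : nontrivialCoComponents Γ) :
    (componentPart Γ s).1 i = component Γ i.1 s :=
  rfl

theorem componentPart_eq_iff (s t : ArtinMonoid Γ) :
    componentPart Γ s = componentPart Γ t ↔
      ∀ i ∈ nontrivialCoComponents Γ, component Γ i s = component Γ i t :=
  ⟨fun h i hi => congrFun (congrArg Subtype.val h) ⟨i, hi⟩,
    fun h => Subtype.ext (funext fun i => h i.1 i.2)⟩

theorem component_inclusion_same (i : CoComponent Γ) (x : ArtinMonoid (coComponentGraph Γ i)) :
    component Γ i (inclusion Γ i.supp x) = x := by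
  have : (component Γ i).comp (inclusion Γ i.supp) = MonoidHom.id _ := hom_ext fun v => by
    rw [MonoidHom.comp_apply, inclusion_gen]
    exact projection_gen_of_mem v.2
  exact DFunLike.congr_fun this x

theorem component_inclusion_of_ne {i j : CoComponent Γ} (hij : j ≠ i)
    (x : ArtinMonoid (coComponentGraph Γ i)) :
    component Γ j (inclusion Γ i.supp x) = 1 := by
  have : (component Γ j).comp (inclusion Γ i.supp) = 1 := hom_ext fun v => by
    rw [MonoidHom.comp_apply, inclusion_gen]
    refine projection_gen_of_notMem fun hv => hij ?_
    have hi := v.2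
    rw [SimpleGraph.ConnectedComponent.mem_supp_iff] at hv hi
    exact hv.symm.trans hi
  exact DFunLike.congr_fun this x

/-! ### The retractions and the direct product decomposition -/

theorem componentPart_componentSumHom (b : ComponentSum Γ) :
    componentPart Γ (componentSumHom Γ b) = b := by
  have : (componentPart Γ).comp (componentSumHom Γ) = MonoidHom.id _ :=
    directSum.hom_ext fun i x => by
      refine Subtype.ext (funext fun j => ?_)
      rw [MonoidHom.comp_apply, componentSumHom_single, componentPart_apply, MonoidHom.id_apply]
      by_cases hji : j = i
      · subst hji
        rw [component_inclusion_same, directSum.coe_single_same]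
      · rw [component_inclusion_of_ne fun e => hji (Subtype.ext e),
          directSum.coe_single_of_ne hji]
  exact DFunLike.congr_fun this b

theorem corePart_gen (v : Γ.universalVerts) :
    corePart Γ (gen Γ v) = Multiplicative.ofAdd (Finsupp.single v 1) :=
  (lift_gen _ _ _).trans (dif_pos v.2)

theorem corePart_gen_of_notMem {v : V} (hv : v ∉ Γ.universalVerts) : corePart Γ (gen Γ v) = 1 :=
  (lift_gen _ _ _).trans (dif_neg hv)

theorem corePart_componentSumHom (b : ComponentSum Γ) :
    corePart Γ (componentSumHom Γ b) = 1 := by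
  have : (corePart Γ).comp (componentSumHom Γ) = 1 := directSum.hom_ext fun i x => by
    rw [MonoidHom.comp_apply, componentSumHom_single]
    have h : (corePart Γ).comp (inclusion Γ i.1.supp) = 1 := hom_ext fun v => by
      rw [MonoidHom.comp_apply, inclusion_gen]
      exact corePart_gen_of_notMem ((mem_nontrivialCoComponents_iff v.2).1 i.2)
    exact DFunLike.congr_fun h x
  exact DFunLike.congr_fun this b

theorem corePart_coreHom (c : Multiplicative (Γ.universalVerts →₀ ℕ)) :
    corePart Γ (coreHom Γ c) = c := by
  have : (corePart Γ).comp (coreHom Γ) = MonoidHom.id _ := freeAbelian_hom_ext fun v => by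
    rw [MonoidHom.comp_apply, coreHom_single, corePart_gen, MonoidHom.id_apply]
  exact DFunLike.congr_fun this c

theorem componentPart_gen {v : V} (hv : v ∈ Γ.universalVerts) :
    componentPart Γ (gen Γ v) = 1 :=
  Subtype.ext <| funext fun i => projection_gen_of_notMem fun h =>
    (mem_nontrivialCoComponents_iff h).1 i.2 hv

theorem componentPart_coreHom (c : Multiplicative (Γ.universalVerts →₀ ℕ)) :
    componentPart Γ (coreHom Γ c) = 1 := by
  have : (componentPart Γ).comp (coreHom Γ) = 1 := freeAbelian_hom_ext fun v => by
    rw [MonoidHom.comp_apply, coreHom_single, componentPart_gen v.2, MonoidHom.one_apply]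
  exact DFunLike.congr_fun this c

/-- The Artin monoid is the direct product of its two parts. -/
theorem componentSumHom_mul_coreHom (s : ArtinMonoid Γ) :
    componentSumHom Γ (componentPart Γ s) * coreHom Γ (corePart Γ s) = s := by
  refine mem_of_gen_mem
    { carrier := {s | componentSumHom Γ (componentPart Γ s) * coreHom Γ (corePart Γ s) = s}
      one_mem' := by simp
      mul_mem' := fun {a b} ha hb => by
        change _ * _ = _
        -- Centrality of the image of `coreHom` permits the interchange of the two middle factors.
        rw [map_mul, map_mul, map_mul, map_mul,
          (coreHom_commute (corePart Γ a) _).mul_mul_mul_comm, ha, hb] } (fun v => ?_) s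
  change _ * _ = _
  by_cases hv : v ∈ Γ.universalVerts
  · rw [componentPart_gen hv, map_one, one_mul, corePart_gen ⟨v, hv⟩, coreHom_single]
  · rw [corePart_gen_of_notMem hv, map_one, mul_one]
    -- A non-universal generator comes from the summand of its own component, where `componentPart`
    -- inverts `componentSumHom`.
    let i : nontrivialCoComponents Γ := ⟨Γᶜ.connectedComponentMk v,
      (mem_nontrivialCoComponents_iff rfl).2 hv⟩
    have hi : gen Γ v = componentSumHom Γ (directSum.single _ i
        (gen (coComponentGraph Γ i) ⟨v, rfl⟩)) := by
      rw [componentSumHom_single, inclusion_gen]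
    rw [hi, componentPart_componentSumHom]

theorem ext_parts {s t : ArtinMonoid Γ} (h₁ : componentPart Γ s = componentPart Γ t)
    (h₂ : corePart Γ s = corePart Γ t) : s = t := by
  rw [← componentSumHom_mul_coreHom s, h₁, h₂, componentSumHom_mul_coreHom]

/-! ### Core and core irreducibles -/

theorem mem_core_iff (s : ArtinMonoid Γ) :
    s ∈ core (ArtinMonoid Γ) ↔ componentPart Γ s = 1 := by
  constructor
  · intro hs
    by_contra hne
    obtain h | ⟨v, t, h⟩ := eq_one_or_exists_gen_mul (componentSumHom Γ (componentPart Γ s))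
    · rw [← componentPart_componentSumHom (componentPart Γ s), h, map_one] at hne
      exact hne rfl
    · have hv : v ∉ Γ.universalVerts := by
        -- A universal first letter would be detected by `corePart`, which kills the image of
        -- `componentSumHom`.
        intro hv
        have := congrArg (corePart Γ) h
        rw [corePart_componentSumHom, map_mul, corePart_gen ⟨v, hv⟩] at this
        have := DFunLike.congr_fun (congrArg Multiplicative.toAdd this) ⟨v, hv⟩
        simp at this
        omega
      have : ∃ w, v ≠ w ∧ ¬ Γ.Adj v w := by
        by_contra! hn
        exact hv fun w hw => hn w hw
      obtain ⟨w, hne, hw⟩ := this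
      obtain ⟨x, y, hxy⟩ := (not_orthogonal_iff _ _).1 (hs (gen Γ w))
      rw [← componentSumHom_mul_coreHom s, h, mul_assoc, mul_assoc] at hxy
      exact gen_mul_ne_gen_mul hne hw _ _ hxy
  · intro hs t
    -- Now `s` is central, so `s * t = t * s` is a common right multiple.
    rw [← componentSumHom_mul_coreHom s, hs, map_one, one_mul]
    exact (not_orthogonal_iff _ _).2 ⟨t, _, (coreHom_commute _ t).symm⟩

theorem mem_core_iff_exists (s : ArtinMonoid Γ) :
    s ∈ core (ArtinMonoid Γ) ↔ ∃ c, coreHom Γ c = s := by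
  rw [mem_core_iff]
  constructor
  · intro h
    refine ⟨corePart Γ s, ?_⟩
    conv_rhs => rw [← componentSumHom_mul_coreHom s, h, map_one, one_mul]
  · rintro ⟨c, rfl⟩
    exact componentPart_coreHom c

/-- The canonical factorisation has its `corePart` as a core factor, so irreducibility kills it.
Conversely, a sum of natural numbers vanishes only if each summand does, so no nontrivial core
factor can split off. -/
theorem mem_unitisedCoreIrreducibles_iff (s : ArtinMonoid Γ) :
    s ∈ unitisedCoreIrreducibles (ArtinMonoid Γ) ↔ corePart Γ s = 1 := by
  constructor
  · rintro (⟨-, h⟩ | rfl)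
    · have := h _ (coreHom Γ (corePart Γ s)) ((mem_core_iff_exists _).2 ⟨_, rfl⟩)
        (componentSumHom_mul_coreHom s).symm
      rw [← corePart_coreHom (corePart Γ s), (isUnit_iff _).1 this, map_one]
    · exact map_one _
  · intro h
    by_cases h1 : s = 1
    · exact Or.inr h1
    · refine Or.inl ⟨fun hc => h1 (ext_parts ?_ ?_), ?_⟩
      · rw [(mem_core_iff s).1 hc, map_one]
      · rw [h, map_one]
      · rintro t a ha rfl
        obtain ⟨c, rfl⟩ := (mem_core_iff_exists a).1 ha
        rw [map_mul, corePart_coreHom] at h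
        have hc : c = 1 := by
          have h' : (corePart Γ t).toAdd + c.toAdd = 0 := h
          exact (add_eq_zero.1 h').2
        rw [hc, map_one]
        exact isUnit_one

theorem mem_coreIrreducibles_iff (s : ArtinMonoid Γ) :
    s ∈ coreIrreducibles (ArtinMonoid Γ) ↔ corePart Γ s = 1 ∧ s ≠ 1 := by
  rw [← mem_unitisedCoreIrreducibles_iff]
  constructor
  · intro h
    refine ⟨Or.inl h, ?_⟩
    rintro rfl
    exact h.1 (one_mem _)
  · rintro ⟨h | h, h1⟩
    · exact h
    · exact absurd h h1

theorem coreRel_iff (s t : ArtinMonoid Γ) :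
    CoreRel s t ↔ componentPart Γ s = componentPart Γ t := by
  constructor
  · rintro ⟨a, ha, b, hb, h⟩
    have := congrArg (componentPart Γ) h
    rwa [map_mul, map_mul, (mem_core_iff a).1 ha, (mem_core_iff b).1 hb, mul_one, mul_one] at this
  · intro h
    -- Each element is multiplied by the core part of the other, which balances the core parts.
    refine ⟨coreHom Γ (corePart Γ t), (mem_core_iff_exists _).2 ⟨_, rfl⟩,
      coreHom Γ (corePart Γ s), (mem_core_iff_exists _).2 ⟨_, rfl⟩, ext_parts ?_ ?_⟩
    · simp only [map_mul, componentPart_coreHom, h]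
    · simp only [map_mul, corePart_coreHom, mul_comm]

theorem isCoreFactorable : IsCoreFactorable (ArtinMonoid Γ) := fun s =>
  ⟨componentSumHom Γ (componentPart Γ s),
    (mem_unitisedCoreIrreducibles_iff _).2 (corePart_componentSumHom _),
    coreHom Γ (corePart Γ s), (mem_core_iff_exists _).2 ⟨_, rfl⟩,
    (componentSumHom_mul_coreHom s).symm⟩

/-- Removing the core part of `r` leaves a common right multiple of `s` and `t`, hence a multiple of
`r` itself; this forces the core part of `r` to be trivial. -/
theorem isInterClosed : IsInterClosed (ArtinMonoid Γ) := by
  intro s hs t ht r h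
  rw [mem_coreIrreducibles_iff] at hs ht ⊢
  have hr : r ∈ rightIdeal s ∩ rightIdeal t := h ▸ ⟨1, (mul_one r).symm⟩
  obtain ⟨⟨x, hx⟩, ⟨y, hy⟩⟩ := hr
  have aux : ∀ u z : ArtinMonoid Γ, corePart Γ u = 1 → r = u * z →
      componentSumHom Γ (componentPart Γ r) ∈ rightIdeal u := fun u z hu hz => by
    refine ⟨componentSumHom Γ (componentPart Γ z), ext_parts ?_ ?_⟩
    · simp only [componentPart_componentSumHom, map_mul, hz]
    · simp only [corePart_componentSumHom, map_mul, hu, mul_one]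
  have hmem : componentSumHom Γ (componentPart Γ r) ∈ rightIdeal r :=
    h ▸ ⟨aux s x hs.1 hx, aux t y ht.1 hy⟩
  obtain ⟨z, hz⟩ := hmem
  refine ⟨?_, ?_⟩
  · have := congrArg (corePart Γ) hz
    rw [corePart_componentSumHom, map_mul] at this
    have h' : (corePart Γ r).toAdd + (corePart Γ z).toAdd = 0 := this.symm
    exact (add_eq_zero.1 h').1
  · rintro rfl
    exact hs.2 (eq_one_of_mul_eq_one hx.symm)

/-- The transversal is all of `S_ci^1`. Comparing core parts in `a * f = t * c` gives `c = a`, so a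
single core part occurs. -/
theorem hasFinitePropagation : HasFinitePropagation (ArtinMonoid Γ) := by
  refine ⟨unitisedCoreIrreducibles (ArtinMonoid Γ), subset_rfl, fun s => ?_, isCoreFactorable,
    fun a ha => (Set.finite_singleton a).subset ?_⟩
  · refine ⟨componentSumHom Γ (componentPart Γ s),
      ⟨(mem_unitisedCoreIrreducibles_iff _).2 (corePart_componentSumHom _), ?_⟩, ?_⟩
    · rw [coreRel_iff, componentPart_componentSumHom]
    · rintro t ⟨ht, hst⟩
      rw [mem_unitisedCoreIrreducibles_iff] at ht
      rw [coreRel_iff] at hst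
      refine ext_parts ?_ ?_
      · rw [componentPart_componentSumHom, hst]
      · rw [ht, corePart_componentSumHom]
  · rintro c ⟨hc, f, hf, t, ht, h⟩
    rw [mem_unitisedCoreIrreducibles_iff] at hf ht
    refine ext_parts ?_ ?_
    · rw [(mem_core_iff c).1 hc, (mem_core_iff a).1 ha]
    · have := congrArg (corePart Γ) h
      rw [map_mul, map_mul, hf, ht, mul_one, one_mul] at this
      exact this.symm

/-! ### The action on the core quotient -/

/-- Core elements have trivial `componentPart`, and only that part survives in the quotient. -/
theorem core_smul (a : core (ArtinMonoid Γ)) (x : CoreQuotient (ArtinMonoid Γ)) : a • x = x := by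
  induction x using Quot.ind with
  | mk s =>
    refine Quot.sound ((coreRel_iff _ _).2 ?_)
    rw [map_mul, (mem_core_iff _).1 a.2, one_mul]

theorem gen_ne_one (v : V) : gen Γ v ≠ 1 := by
  intro h
  have := congrArg (fun x => (length Γ x).toAdd) h
  simp [length, lift_gen] at this

theorem gen_mem_core_iff (v : V) : gen Γ v ∈ core (ArtinMonoid Γ) ↔ v ∈ Γ.universalVerts := by
  refine ⟨fun h => ?_, fun h => (mem_core_iff _).2 (componentPart_gen h)⟩
  by_contra hv
  exact gen_ne_one v (ext_parts (((mem_core_iff _).1 h).trans (map_one _).symm)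
    ((corePart_gen_of_notMem hv).trans (map_one _).symm))

theorem universalVerts_eq_empty_iff :
    Γ.universalVerts = ∅ ↔ core (ArtinMonoid Γ) = ⊥ := by
  constructor
  · intro h
    refine (Submonoid.eq_bot_iff_forall _).2 fun s hs => ?_
    obtain ⟨c, rfl⟩ := (mem_core_iff_exists s).1 hs
    have : c = 1 := Finsupp.ext fun v => absurd v.2 (by simp [h])
    rw [this, map_one]
  · intro h
    refine Set.eq_empty_of_forall_notMem fun v hv => gen_ne_one (Γ := Γ) v ?_
    exact (Submonoid.eq_bot_iff_forall _).1 h _ ((gen_mem_core_iff v).2 hv)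

theorem faithfulSMul_iff :
    FaithfulSMul (core (ArtinMonoid Γ)) (CoreQuotient (ArtinMonoid Γ)) ↔
      ¬ ∃ v, v ∈ Γ.universalVerts := by
  constructor
  · rintro ⟨h⟩ ⟨v, hv⟩
    have := h (m₁ := ⟨gen Γ v, (gen_mem_core_iff v).2 hv⟩) (m₂ := 1) fun x => by
      rw [core_smul, core_smul]
    exact gen_ne_one v (congrArg Subtype.val this)
  · intro h
    have hbot := universalVerts_eq_empty_iff.1 (Set.eq_empty_of_forall_notMem fun v hv => h ⟨v, hv⟩)
    refine ⟨fun {a b} _ => Subtype.ext ?_⟩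
    rw [(Submonoid.eq_bot_iff_forall _).1 hbot a a.2, (Submonoid.eq_bot_iff_forall _).1 hbot b b.2]

/-- `componentPart` descends to the quotient and separates the powers of a non-universal generator,
since these have trivial `corePart` and distinct lengths. -/
theorem infinite_coreQuotient {v : V} (hv : v ∉ Γ.universalVerts) :
    Infinite (CoreQuotient (ArtinMonoid Γ)) := by
  refine Infinite.of_injective (fun n : ℕ => (Quot.mk _ (gen Γ v ^ n) :
    CoreQuotient (ArtinMonoid Γ))) fun m n h => ?_
  have hmn : componentPart Γ (gen Γ v ^ m) = componentPart Γ (gen Γ v ^ n) :=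
    congrArg (Quot.lift (componentPart Γ) fun s t => (coreRel_iff s t).1) h
  have : gen Γ v ^ m = gen Γ v ^ n := ext_parts hmn (by
    rw [map_pow, map_pow, corePart_gen_of_notMem hv, one_pow, one_pow])
  have := congrArg (fun x => (length Γ x).toAdd) this
  simpa [length, lift_gen] using this

theorem isAlmostFree_iff :
    IsAlmostFree (core (ArtinMonoid Γ)) (CoreQuotient (ArtinMonoid Γ)) ↔
      Γ.universalVerts = ∅ ∨ Γ.universalVerts = Set.univ := by
  constructor
  · intro h
    by_contra! hn
    obtain ⟨v, hv⟩ := hn.1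
    obtain ⟨w, hw⟩ := (Set.ne_univ_iff_exists_notMem _).1 hn.2
    have := infinite_coreQuotient hw
    -- The generator at `v` and `1` are distinct core elements that agree on the whole infinite
    -- quotient.
    refine Set.infinite_univ ((h ⟨gen Γ v, (gen_mem_core_iff v).2 hv⟩ 1 fun e =>
      gen_ne_one v (congrArg Subtype.val e)).subset fun x _ => ?_)
    change _ • x = _ • x
    rw [core_smul, core_smul]
  · rintro (h | h) a b hab
    · have hbot := (Submonoid.eq_bot_iff_forall _).1 (universalVerts_eq_empty_iff.1 h)
      exact absurd (Subtype.ext ((hbot a a.2).trans (hbot b b.2).symm)) hab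
    -- With all vertices universal, `componentPart` is trivial and the quotient is a single point.
    · refine Set.Subsingleton.finite fun x _ y _ => ?_
      induction x using Quot.ind with
      | mk s =>
        induction y using Quot.ind with
        | mk t =>
          have key : componentPart Γ = 1 := hom_ext fun v => componentPart_gen (h ▸ Set.mem_univ v)
          exact Quot.sound ((coreRel_iff _ _).2 (by rw [key]; rfl))

theorem universalVerts_eq_univ_iff :
    Γ.universalVerts = Set.univ ↔
      ∃ e : ArtinMonoid Γ ≃* Multiplicative (V →₀ ℕ),
        ∀ v, e (gen Γ v) = Multiplicative.ofAdd (Finsupp.single v 1) := by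
  constructor
  · intro h
    have hu : ∀ v, v ∈ Γ.universalVerts := fun v => h ▸ Set.mem_univ v
    let f : Multiplicative (V →₀ ℕ) →* ArtinMonoid Γ :=
      centralHom (gen Γ) fun v => gen_commute_of_mem_universalVerts (hu v)
    have hf : ∀ v, f (Multiplicative.ofAdd (Finsupp.single v 1)) = gen Γ v :=
      centralHom_single _ _
    let g : ArtinMonoid Γ →* Multiplicative (V →₀ ℕ) :=
      lift (fun v => Multiplicative.ofAdd (Finsupp.single v 1)) fun _ _ _ => Commute.all _ _
    have hg : ∀ v, g (gen Γ v) = Multiplicative.ofAdd (Finsupp.single v 1) := lift_gen _ _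
    refine ⟨MonoidHom.toMulEquiv g f (hom_ext fun v => ?_)
      (freeAbelian_hom_ext fun v => ?_), hg⟩
    · rw [MonoidHom.comp_apply, hg, hf, MonoidHom.id_apply]
    · rw [MonoidHom.comp_apply, hf, hg, MonoidHom.id_apply]
  · rintro ⟨e, -⟩
    -- Commutativity transfers along `e`, and distinct commuting generators belong to adjacent
    -- vertices.
    refine Set.eq_univ_of_forall fun v w hvw => ?_
    refine (gen_commute_iff.1 ?_).resolve_left hvw
    exact e.injective (by rw [map_mul, map_mul, mul_comm])

end ArtinMonoid

theorem mainTheorem10 {V : Type*} (Γ : SimpleGraph V) :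
    -- (i) units, core and unitised core irreducibles
    ((∀ s : ArtinMonoid Γ, IsUnit s ↔ s = 1) ∧
      (∃ φ : Multiplicative (Γ.universalVerts →₀ ℕ) →* ArtinMonoid Γ,
        Function.Injective φ ∧
        (∀ v : Γ.universalVerts,
          φ (Multiplicative.ofAdd (Finsupp.single v 1)) = ArtinMonoid.gen Γ v) ∧
        core (ArtinMonoid Γ) = MonoidHom.mrange φ) ∧
      (∃ ψ : directSum (fun i : nontrivialCoComponents Γ =>
            ArtinMonoid (coComponentGraph Γ i)) →* ArtinMonoid Γ,
        Function.Injective ψ ∧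
        (∀ (i : nontrivialCoComponents Γ) (x : ArtinMonoid (coComponentGraph Γ i)),
          ψ (directSum.single (fun i : nontrivialCoComponents Γ =>
            ArtinMonoid (coComponentGraph Γ i)) i x) =
              ArtinMonoid.inclusion Γ i.1.supp x) ∧
        unitisedCoreIrreducibles (ArtinMonoid Γ) = Set.range ψ)) ∧
    -- (ii) the core relation
    (∀ s t : ArtinMonoid Γ, CoreRel s t ↔
      ∀ i ∈ nontrivialCoComponents Γ,
        ArtinMonoid.component Γ i s = ArtinMonoid.component Γ i t) ∧
    -- (iii) core factorability, intersections and finite propagation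
    (IsCoreFactorable (ArtinMonoid Γ) ∧ IsInterClosed (ArtinMonoid Γ) ∧
      HasFinitePropagation (ArtinMonoid Γ)) ∧
    -- (iv) faithfulness
    (FaithfulSMul (core (ArtinMonoid Γ)) (CoreQuotient (ArtinMonoid Γ)) ↔
      ¬ ∃ v, v ∈ Γ.universalVerts) ∧
    -- (v) almost freeness
    ((IsAlmostFree (core (ArtinMonoid Γ)) (CoreQuotient (ArtinMonoid Γ)) ↔
        Γ.universalVerts = ∅ ∨ Γ.universalVerts = Set.univ) ∧
      (Γ.universalVerts = ∅ ↔ core (ArtinMonoid Γ) = ⊥) ∧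
      (Γ.universalVerts = Set.univ ↔
        ∃ e : ArtinMonoid Γ ≃* Multiplicative (V →₀ ℕ),
          ∀ v, e (ArtinMonoid.gen Γ v) = Multiplicative.ofAdd (Finsupp.single v 1))) := by
  refine ⟨⟨ArtinMonoid.isUnit_iff, ?_, ?_⟩, ?_, ?_, ArtinMonoid.faithfulSMul_iff,
    ArtinMonoid.isAlmostFree_iff, ArtinMonoid.universalVerts_eq_empty_iff,
    ArtinMonoid.universalVerts_eq_univ_iff⟩
  · refine ⟨ArtinMonoid.coreHom Γ, Function.LeftInverse.injective ArtinMonoid.corePart_coreHom,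
      ArtinMonoid.coreHom_single, Submonoid.ext fun s => ?_⟩
    rw [ArtinMonoid.mem_core_iff_exists, MonoidHom.mem_mrange]
  · refine ⟨ArtinMonoid.componentSumHom Γ,
      Function.LeftInverse.injective ArtinMonoid.componentPart_componentSumHom,
      ArtinMonoid.componentSumHom_single, Set.ext fun s => ?_⟩
    rw [ArtinMonoid.mem_unitisedCoreIrreducibles_iff]
    constructor
    · intro h
      refine ⟨ArtinMonoid.componentPart Γ s, ?_⟩
      conv_rhs => rw [← ArtinMonoid.componentSumHom_mul_coreHom s, h, map_one, mul_one]
    · rintro ⟨b, rfl⟩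
      exact ArtinMonoid.corePart_componentSumHom b
  · intro s t
    rw [ArtinMonoid.coreRel_iff, ArtinMonoid.componentPart_eq_iff]
  · exact ⟨ArtinMonoid.isCoreFactorable, ArtinMonoid.isInterClosed,
      ArtinMonoid.hasFinitePropagation⟩
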